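/- For a closed linear subspace $M$ of a complex Banach space $B$, let $\lambda(M,B)=\inf\|P\|\in[0,\infty]$, where the infimum runs over all bounded linear projections $P$ from $B$ onto $M$, and $\lambda(M,B)=\infty$ if there is no such projection. Let $H_1,H_2$ be complex Hilbert spaces, let $M_1\subset B(H_1)$ and $M_2\subset B(H_2)$ be von Neumann algebras, let $H_1\otimes H_2$ be the Hilbert space tensor product, and let $M=M_1\otimes M_2\subset B(H_1\otimes H_2)$ be their von Neumann tensor product, i.e. the weak*-closure in $B(H_1\otimes H_2)$ of the linear span of the operators $a\otimes b$ with $a\in M_1$, $b\in M_2$. Then $$\lambda(M,B(H_1\otimes H_2))\ \ge\ \lambda(M_1,B(H_1))\,\lambda(M_2,B(H_2)),$$ as an inequality in $[0,\infty]$, with the convention $0\cdot\infty=0$ (which can matter only if $H_1=\{0\}$ or $H_2=\{0\}$). -/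

import Mathlib

open scoped TensorProduct InnerProductSpace

noncomputable section

/-- The projection constant `λ(M, B)` of a subspace `M` of a normed space `B`: the infimum of the
norms of the bounded linear projections from `B` onto `M`, as an element of `[0, ∞]`; it is `∞`
when there is no such projection. -/
def projectionConstant {B : Type*} [NormedAddCommGroup B] [NormedSpace ℂ B]
    (M : Submodule ℂ B) : ENNReal :=
  ⨅ (P : B →L[ℂ] M) (_ : ∀ x : M, P x = x), ‖P‖ₑ

/-- The vector functional `T ↦ ⟪x, T y⟫` on `B(H)`. -/
def vectorFunctional {H : Type*} [NormedAddCommGroup H] [InnerProductSpace ℂ H] (x y : H) :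
    StrongDual ℂ (H →L[ℂ] H) :=
  (innerSL ℂ x).comp (ContinuousLinearMap.apply ℂ H y)

/-- The predual of `B(H)`, realised inside the dual of `B(H)` as the norm closure of the linear
span of the vector functionals. (Under `t ↦ tr(t ·)` this is the space of trace class
operators with the trace norm.) -/
def operatorPredual (H : Type*) [NormedAddCommGroup H] [InnerProductSpace ℂ H] :
    Submodule ℂ (StrongDual ℂ (H →L[ℂ] H)) :=
  (Submodule.span ℂ (Set.range fun p : H × H => vectorFunctional p.1 p.2)).topologicalClosure

/-- The duality pairing `(T, φ) ↦ φ T` between `B(H)` and its predual. -/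
def operatorPairing (H : Type*) [NormedAddCommGroup H] [InnerProductSpace ℂ H] :
    (H →L[ℂ] H) →ₗ[ℂ] operatorPredual H →ₗ[ℂ] ℂ :=
  ((ContinuousLinearMap.coeLM ℂ).comp (operatorPredual H).subtype).flip

/-- The closure of a subspace of `B(H)` in the weak* topology `σ(B(H), B(H)_*)`, i.e. the
coarsest topology that makes every functional in the predual of `B(H)` continuous. -/
def weakStarClosure {H : Type*} [NormedAddCommGroup H] [InnerProductSpace ℂ H]
    (S : Submodule ℂ (H →L[ℂ] H)) :
    Submodule ℂ (H →L[ℂ] H) :=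
  Submodule.topologicalClosure (R := ℂ) (M := WeakBilin (operatorPairing H)) S

section Tensor

/-- The Hilbert space tensor product: the completion of the algebraic tensor product for the
inner product with `⟪x ⊗ y, x' ⊗ y'⟫ = ⟪x, x'⟫ * ⟪y, y'⟫`. -/
abbrev HilbertTensor (H₁ H₂ : Type*) [NormedAddCommGroup H₁] [InnerProductSpace ℂ H₁]
    [NormedAddCommGroup H₂] [InnerProductSpace ℂ H₂] : Type _ :=
  UniformSpace.Completion (H₁ ⊗[ℂ] H₂)

variable {H₁ H₂ : Type*} [NormedAddCommGroup H₁] [InnerProductSpace ℂ H₁] [CompleteSpace H₁]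
  [NormedAddCommGroup H₂] [InnerProductSpace ℂ H₂] [CompleteSpace H₂]

/-- The bounded operator `a ⊗ b` on the Hilbert space tensor product, determined by
`(a ⊗ b) (x ⊗ y) = a x ⊗ b y`. -/
def tensorOperator (a : H₁ →L[ℂ] H₁) (b : H₂ →L[ℂ] H₂) :
    HilbertTensor H₁ H₂ →L[ℂ] HilbertTensor H₁ H₂ :=
  (TensorProduct.mapL a b).completion

/-- The von Neumann tensor product of `M₁ ⊆ B(H₁)` and `M₂ ⊆ B(H₂)`: the weak* closure in the
bounded operators on the Hilbert space tensor product of the algebraic tensor product of `M₁` and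
`M₂`, that is, of the linear span of the operators `a ⊗ b` with `a ∈ M₁` and `b ∈ M₂`. -/
def vonNeumannTensor (M₁ : VonNeumannAlgebra H₁) (M₂ : VonNeumannAlgebra H₂) :
    Submodule ℂ (HilbertTensor H₁ H₂ →L[ℂ] HilbertTensor H₁ H₂) :=
  weakStarClosure
    (Submodule.span ℂ {T | ∃ a ∈ M₁, ∃ b ∈ M₂, T = tensorOperator a b})

end Tensor

end

/-! A projection `P` onto `M₁ ⊗ M₂` of norm at most `C` yields one onto `M₁` of norm at most `C /
λ₂`, with `λ₂` the constant of `M₂`. For fixed `b`, `x`, `y`, slicing `P (b ⊗ c)` by `⟪x, · y⟫`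
gives an operator `c ↦ R c` on `B(H₂)` with values in `M₂`; if `b ∈ M₁`, it acts on `M₂` as the
scalar `⟪x, b y⟫`. An operator into `M₂` acting there as `t` has norm at least `|t| λ₂`, so
Hahn-Banach gives a functional `τ` of norm at most `1 / λ₂` that reads off `t`
(`exists_scalar_functional`). The form `(x, y) ↦ τ R` defines an operator `P₁ b`, in `M₁` by the
double commutant theorem, and `P₁` is the desired projection
(`projectionConstant_le_enorm_mul_enorm`). -/

open scoped TensorProduct InnerProductSpace

noncomputable section

/-! ### Projection constants and the scalar functional. -/

section ProjectionConstant

variable {B : Type*} [NormedAddCommGroup B] [NormedSpace ℂ B] {M : Submodule ℂ B}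

theorem projectionConstant_le {P : B →L[ℂ] B} (hmem : ∀ x, P x ∈ M) (hP : ∀ x ∈ M, P x = x) :
    projectionConstant M ≤ ‖P‖ₑ := by
  refine (iInf₂_le (P.codRestrict M hmem) fun x : M => Subtype.ext (hP x x.2)).trans ?_
  exact enorm_le_iff_norm_le.mpr
    (ContinuousLinearMap.opNorm_le_bound _ (norm_nonneg _) P.le_opNorm)

theorem le_projectionConstant {k : ENNReal}
    (h : ∀ (P : B →ₗ[ℂ] B) (C : NNReal), (∀ x, ‖P x‖ ≤ C * ‖x‖) → (∀ x, P x ∈ M) →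
      (∀ x ∈ M, P x = x) → k ≤ C) :
    k ≤ projectionConstant M :=
  le_iInf₂ fun P hP => h (M.subtype.comp P.toLinearMap) ‖P‖₊ P.le_opNorm (fun x => (P x).2)
    fun x hx => congrArg Subtype.val (hP ⟨x, hx⟩)

theorem projectionConstant_bot : projectionConstant (⊥ : Submodule ℂ B) = 0 := by
  refine le_antisymm ((projectionConstant_le (P := 0) ?_ ?_).trans ?_) zero_le
  · simp
  · simp +contextual
  · exact (enorm_zero (E := B →L[ℂ] B)).le

/-- For `t ≠ 0`, the operator `t⁻¹ • R` is a projection onto `M`. -/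
theorem enorm_mul_projectionConstant_le {R : B →L[ℂ] B} (hmem : ∀ x, R x ∈ M) {t : ℂ}
    (hR : ∀ x ∈ M, R x = t • x) : ‖t‖ₑ * projectionConstant M ≤ ‖R‖ₑ := by
  rcases eq_or_ne t 0 with rfl | ht
  · simp
  have h : projectionConstant M ≤ ‖t⁻¹ • R‖ₑ :=
    projectionConstant_le (fun x => M.smul_mem _ (hmem x)) fun x hx => by
      simp [hR x hx, smul_smul, ht]
  calc ‖t‖ₑ * projectionConstant M ≤ ‖t‖ₑ * ‖t⁻¹ • R‖ₑ := by gcongr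
    _ = ‖R‖ₑ := by rw [← enorm_smul, smul_inv_smul₀ ht]

/-- A bounded functional on the operators which reads off the scalar by which an operator with
range in `M` acts on `M`. -/
theorem exists_scalar_functional (h : projectionConstant M ≠ 0) :
    ∃ τ : StrongDual ℂ (B →L[ℂ] B), ‖τ‖ ≤ (projectionConstant M)⁻¹.toReal ∧
      ∀ (R : B →L[ℂ] B) (t : ℂ), (∀ x, R x ∈ M) → (∀ x ∈ M, R x = t • x) → τ R = t := by
  have hM : M ≠ ⊥ := by
    rintro rfl
    exact h projectionConstant_bot
  -- A nonzero `m ∈ M` determines the scalar as `g (R m) / g m`, which is visibly linear in `R`.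
  obtain ⟨m, hm, hm₀⟩ := M.exists_mem_ne_zero_of_ne_bot hM
  obtain ⟨g, -, hg⟩ := exists_dual_vector ℂ m (by simpa using hm₀)
  have hg₀ : g m ≠ 0 := by simpa [hg] using hm₀
  let W : Submodule ℂ (B →L[ℂ] B) :=
    { carrier := {R | (∀ x, R x ∈ M) ∧ ∃ t : ℂ, ∀ x ∈ M, R x = t • x}
      add_mem' := by
        rintro R R' ⟨h, t, ht⟩ ⟨h', t', ht'⟩
        exact ⟨fun x => M.add_mem (h x) (h' x), t + t', fun x hx => by
          simp [ht x hx, ht' x hx, add_smul]⟩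
      zero_mem' := ⟨by simp, 0, by simp⟩
      smul_mem' := by
        rintro c R ⟨h, t, ht⟩
        exact ⟨fun x => M.smul_mem c (h x), c * t, fun x hx => by simp [ht x hx, mul_smul]⟩ }
  let f : Module.Dual ℂ W :=
    { toFun := fun R => (g m)⁻¹ * g (R.1 m)
      map_add' := fun R R' => by simp [mul_add]
      map_smul' := fun c R => by simp; ring }
  have hf (R : W) (t : ℂ) (ht : ∀ x ∈ M, R.1 x = t • x) : f R = t := by
    simp [f, ht m hm]; field_simp
  have hbound (R : W) : ‖f R‖ ≤ (projectionConstant M)⁻¹.toReal * ‖R.1‖ := by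
    obtain ⟨hmem, t, ht⟩ := R.2
    rw [hf R t ht]
    have h₁ : ‖t‖ₑ ≤ (projectionConstant M)⁻¹ * ‖R.1‖ₑ := by
      rw [mul_comm, ← div_eq_mul_inv, ENNReal.le_div_iff_mul_le (.inl h) (.inr (by simp))]
      exact enorm_mul_projectionConstant_le hmem ht
    have h₂ := ENNReal.toReal_mono (ENNReal.mul_ne_top (by simpa using h) (by simp)) h₁
    simpa using h₂
  -- Hahn-Banach; if the projection constant is `∞`, the seminorm is `0` and so is `τ`.
  obtain ⟨τ, hτ, hle⟩ := Module.Dual.exists_extension_of_le_seminorm W f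
    (p := (projectionConstant M)⁻¹.toNNReal • normSeminorm ℂ (B →L[ℂ] B)) hbound
  refine ⟨τ.mkContinuous (projectionConstant M)⁻¹.toReal hle,
    LinearMap.mkContinuous_norm_le _ ENNReal.toReal_nonneg _, fun R t hmem ht => ?_⟩
  exact (hτ ⟨R, hmem, t, ht⟩).trans (hf _ t ht)

end ProjectionConstant

/-! ### Weak* closure and commutants through matrix coefficients. -/

theorem vectorFunctional_mem_operatorPredual {H : Type*} [NormedAddCommGroup H]
    [InnerProductSpace ℂ H] (x y : H) : vectorFunctional x y ∈ operatorPredual H :=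
  Submodule.le_topologicalClosure _ (Submodule.subset_span ⟨(x, y), rfl⟩)

/-- Linear relations between matrix coefficients pass to the weak* closure. -/
theorem inner_eq_of_mem_weakStarClosure {H : Type*} [NormedAddCommGroup H] [InnerProductSpace ℂ H]
    {S : Set (H →L[ℂ] H)} {x y x' y' : H} (h : ∀ T ∈ S, ⟪x, T y⟫_ℂ = ⟪x', T y'⟫_ℂ)
    {T : H →L[ℂ] H} (hT : T ∈ weakStarClosure (Submodule.span ℂ S)) :
    ⟪x, T y⟫_ℂ = ⟪x', T y'⟫_ℂ := by
  have hspan : ∀ T ∈ Submodule.span ℂ S, ⟪x, T y⟫_ℂ = ⟪x', T y'⟫_ℂ := by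
    intro T hT
    induction hT using Submodule.span_induction with
    | mem T hT => exact h T hT
    | zero => simp
    | add T T' _ _ h h' => simp [h, h']
    | smul c T _ h => simp [h]
  have hcont (x y : H) : Continuous fun T : WeakBilin (operatorPairing H) =>
      ⟪x, (show H →L[ℂ] H from T) y⟫_ℂ :=
    WeakBilin.eval_continuous (operatorPairing H)
      ⟨vectorFunctional x y, vectorFunctional_mem_operatorPredual x y⟩
  have hclosed : IsClosed {T : WeakBilin (operatorPairing H) |
      ⟪x, (show H →L[ℂ] H from T) y⟫_ℂ = ⟪x', (show H →L[ℂ] H from T) y'⟫_ℂ} :=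
    isClosed_eq (hcont x y) (hcont x' y')
  exact closure_minimal (X := WeakBilin (operatorPairing H)) hspan hclosed hT

theorem VonNeumannAlgebra.mem_of_commutes {H : Type*} [NormedAddCommGroup H]
    [InnerProductSpace ℂ H] [CompleteSpace H] (M : VonNeumannAlgebra H) {T : H →L[ℂ] H}
    (h : ∀ a ∈ M.commutant, ∀ x y : H,
      ⟪ContinuousLinearMap.adjoint a x, T y⟫_ℂ = ⟪x, T (a y)⟫_ℂ) : T ∈ M := by
  rw [← M.commutant_commutant, mem_commutant_iff]
  intro a ha
  ext y
  refine ext_inner_left ℂ fun x => ?_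
  simpa [ContinuousLinearMap.adjoint_inner_left] using h a ha x y

/-! ### Operators on the Hilbert space tensor product. -/

section Tensor

variable {H₁ H₂ : Type*} [NormedAddCommGroup H₁] [InnerProductSpace ℂ H₁]
  [NormedAddCommGroup H₂] [InnerProductSpace ℂ H₂]

variable (H₂) in
/-- The operator `z ↦ x ⊗ z` from `H₂` to the Hilbert space tensor product. -/
def leftTensor (x : H₁) : H₂ →L[ℂ] HilbertTensor H₁ H₂ :=
  UniformSpace.Completion.toComplL.comp (TensorProduct.mkL ℂ H₁ H₂ x)

theorem leftTensor_apply (x : H₁) (z : H₂) :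
    leftTensor H₂ x z = ((x ⊗ₜ[ℂ] z : H₁ ⊗[ℂ] H₂) : HilbertTensor H₁ H₂) := rfl

theorem leftTensor_add (x x' : H₁) :
    leftTensor H₂ (x + x') = leftTensor H₂ x + leftTensor H₂ x' := by
  ext z
  simp only [leftTensor_apply, TensorProduct.add_tmul, add_apply, UniformSpace.Completion.coe_add]

theorem leftTensor_smul (c : ℂ) (x : H₁) : leftTensor H₂ (c • x) = c • leftTensor H₂ x := by
  ext z
  simp only [leftTensor_apply, ← TensorProduct.smul_tmul', smul_apply,
    UniformSpace.Completion.coe_smul]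

theorem norm_leftTensor_le (x : H₁) : ‖leftTensor H₂ x‖ ≤ ‖x‖ :=
  ContinuousLinearMap.opNorm_le_bound _ (norm_nonneg _) fun z => by simp [leftTensor_apply]

theorem inner_leftTensor (x x' : H₁) (z z' : H₂) :
    ⟪leftTensor H₂ x z, leftTensor H₂ x' z'⟫_ℂ = ⟪x, x'⟫_ℂ * ⟪z, z'⟫_ℂ := by
  simp [leftTensor_apply]

theorem tensorOperator_coe (a : H₁ →L[ℂ] H₁) (b : H₂ →L[ℂ] H₂) (u : H₁ ⊗[ℂ] H₂) :
    tensorOperator a b u = (TensorProduct.mapL a b u : H₁ ⊗[ℂ] H₂) :=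
  ContinuousLinearMap.completion_apply_coe _ _

theorem tensorOperator_leftTensor (a : H₁ →L[ℂ] H₁) (b : H₂ →L[ℂ] H₂) (x : H₁) (z : H₂) :
    tensorOperator a b (leftTensor H₂ x z) = leftTensor H₂ (a x) (b z) :=
  tensorOperator_coe a b _

theorem HilbertTensor.continuousLinearMap_ext {E : Type*} [NormedAddCommGroup E] [NormedSpace ℂ E]
    {S T : HilbertTensor H₁ H₂ →L[ℂ] E} (h : ∀ u : H₁ ⊗[ℂ] H₂, S u = T u) : S = T :=
  DFunLike.coe_injective (UniformSpace.Completion.ext S.continuous T.continuous h)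

theorem tensorOperator_add_left (a a' : H₁ →L[ℂ] H₁) (b : H₂ →L[ℂ] H₂) :
    tensorOperator (a + a') b = tensorOperator a b + tensorOperator a' b :=
  HilbertTensor.continuousLinearMap_ext fun u => by
    simp only [tensorOperator_coe, TensorProduct.mapL_add_left, add_apply,
      UniformSpace.Completion.coe_add]

theorem tensorOperator_add_right (a : H₁ →L[ℂ] H₁) (b b' : H₂ →L[ℂ] H₂) :
    tensorOperator a (b + b') = tensorOperator a b + tensorOperator a b' :=
  HilbertTensor.continuousLinearMap_ext fun u => by
    simp only [tensorOperator_coe, TensorProduct.mapL_add_right, add_apply,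
      UniformSpace.Completion.coe_add]

theorem tensorOperator_smul_left (c : ℂ) (a : H₁ →L[ℂ] H₁) (b : H₂ →L[ℂ] H₂) :
    tensorOperator (c • a) b = c • tensorOperator a b :=
  HilbertTensor.continuousLinearMap_ext fun u => by
    simp only [tensorOperator_coe, TensorProduct.mapL_smul_left, smul_apply,
      UniformSpace.Completion.coe_smul]

theorem tensorOperator_smul_right (c : ℂ) (a : H₁ →L[ℂ] H₁) (b : H₂ →L[ℂ] H₂) :
    tensorOperator a (c • b) = c • tensorOperator a b :=
  HilbertTensor.continuousLinearMap_ext fun u => by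
    simp only [tensorOperator_coe, TensorProduct.mapL_smul_right, smul_apply,
      UniformSpace.Completion.coe_smul]

theorem norm_tensorOperator_le (a : H₁ →L[ℂ] H₁) (b : H₂ →L[ℂ] H₂) :
    ‖tensorOperator a b‖ ≤ ‖a‖ * ‖b‖ := by
  refine ContinuousLinearMap.opNorm_le_bound _ (by positivity) fun u => ?_
  induction u using UniformSpace.Completion.induction_on with
  | hp => exact isClosed_le (by fun_prop) (by fun_prop)
  | ih u =>
    rw [tensorOperator_coe, UniformSpace.Completion.norm_coe, UniformSpace.Completion.norm_coe]
    exact (TensorProduct.mapL a b).le_of_opNorm_le (TensorProduct.norm_mapL_le a b) u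

/-! ### Slices and sliced maps. -/

variable [CompleteSpace H₂]

/-- The slice of `T` by the vector functional `⟪x, · y⟫` on the first tensor factor. -/
def slice (x y : H₁) (T : HilbertTensor H₁ H₂ →L[ℂ] HilbertTensor H₁ H₂) : H₂ →L[ℂ] H₂ :=
  (ContinuousLinearMap.adjoint (leftTensor H₂ x)).comp (T.comp (leftTensor H₂ y))

theorem inner_slice (x y : H₁) (T : HilbertTensor H₁ H₂ →L[ℂ] HilbertTensor H₁ H₂) (z w : H₂) :
    ⟪z, slice x y T w⟫_ℂ = ⟪leftTensor H₂ x z, T (leftTensor H₂ y w)⟫_ℂ := by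
  simp [slice, ContinuousLinearMap.adjoint_inner_right]

theorem norm_slice_le (x y : H₁) (T : HilbertTensor H₁ H₂ →L[ℂ] HilbertTensor H₁ H₂) :
    ‖slice x y T‖ ≤ ‖x‖ * ‖y‖ * ‖T‖ := by
  have hx : ‖ContinuousLinearMap.adjoint (leftTensor H₂ x)‖ ≤ ‖x‖ := by
    rw [LinearIsometryEquiv.norm_map]
    exact norm_leftTensor_le x
  calc ‖slice x y T‖ ≤ ‖x‖ * (‖T‖ * ‖y‖) := by
        refine (ContinuousLinearMap.opNorm_comp_le _ _).trans ?_
        gcongr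
        refine (ContinuousLinearMap.opNorm_comp_le _ _).trans ?_
        gcongr
        exact norm_leftTensor_le y
    _ = _ := by ring

variable {P : (HilbertTensor H₁ H₂ →L[ℂ] HilbertTensor H₁ H₂) →ₗ[ℂ]
    (HilbertTensor H₁ H₂ →L[ℂ] HilbertTensor H₁ H₂)} {C : NNReal} (hC : ∀ T, ‖P T‖ ≤ C * ‖T‖)

/-- The operator `c ↦ (ω ⊗ id) (P (b ⊗ c))` on `B(H₂)`, where `ω` is the vector functional
`⟪x, · y⟫`. -/
def slicedMap (x y : H₁) (b : H₁ →L[ℂ] H₁) : (H₂ →L[ℂ] H₂) →L[ℂ] (H₂ →L[ℂ] H₂) :=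
  LinearMap.mkContinuous
    { toFun := fun c => slice x y (P (tensorOperator b c))
      map_add' := fun c c' => by simp [tensorOperator_add_right, slice]
      map_smul' := fun t c => by simp [tensorOperator_smul_right, slice] }
    (C * ‖b‖ * ‖x‖ * ‖y‖) fun c => by
      calc ‖slice x y (P (tensorOperator b c))‖
          ≤ ‖x‖ * ‖y‖ * (C * (‖b‖ * ‖c‖)) := by
            refine (norm_slice_le _ _ _).trans ?_
            gcongr
            refine (hC _).trans ?_
            gcongr
            exact norm_tensorOperator_le b c
        _ = _ := by ring

theorem slicedMap_apply (x y : H₁) (b : H₁ →L[ℂ] H₁) (c : H₂ →L[ℂ] H₂) :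
    slicedMap hC x y b c = slice x y (P (tensorOperator b c)) := rfl

theorem norm_slicedMap_le (x y : H₁) (b : H₁ →L[ℂ] H₁) :
    ‖slicedMap hC x y b‖ ≤ C * ‖b‖ * ‖x‖ * ‖y‖ :=
  LinearMap.mkContinuous_norm_le _ (by positivity) _

theorem slicedMap_add_left (x x' y : H₁) (b : H₁ →L[ℂ] H₁) :
    slicedMap hC (x + x') y b = slicedMap hC x y b + slicedMap hC x' y b := by
  ext c : 1
  simp [slicedMap_apply, slice, leftTensor_add]

theorem slicedMap_smul_left (t : ℂ) (x y : H₁) (b : H₁ →L[ℂ] H₁) :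
    slicedMap hC (t • x) y b = starRingEnd ℂ t • slicedMap hC x y b := by
  ext c : 1
  simp only [slicedMap_apply, slice, leftTensor_smul, map_smulₛₗ, ContinuousLinearMap.smul_comp,
    smul_apply]

theorem slicedMap_add_middle (x y y' : H₁) (b : H₁ →L[ℂ] H₁) :
    slicedMap hC x (y + y') b = slicedMap hC x y b + slicedMap hC x y' b := by
  ext c : 1
  simp [slicedMap_apply, slice, leftTensor_add]

theorem slicedMap_smul_middle (t : ℂ) (x y : H₁) (b : H₁ →L[ℂ] H₁) :
    slicedMap hC x (t • y) b = t • slicedMap hC x y b := by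
  ext c : 1
  simp [slicedMap_apply, slice, leftTensor_smul]

theorem slicedMap_add_right (x y : H₁) (b b' : H₁ →L[ℂ] H₁) :
    slicedMap hC x y (b + b') = slicedMap hC x y b + slicedMap hC x y b' := by
  ext c : 1
  simp [slicedMap_apply, slice, tensorOperator_add_left]

theorem slicedMap_smul_right (t : ℂ) (x y : H₁) (b : H₁ →L[ℂ] H₁) :
    slicedMap hC x y (t • b) = t • slicedMap hC x y b := by
  ext c : 1
  simp [slicedMap_apply, slice, tensorOperator_smul_left]

/-! ### Slices of the von Neumann tensor product. -/

variable [CompleteSpace H₁]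

/-- In terms of coefficients, `T` commutes with `a ⊗ b`. This is clear for elementary tensors and
survives weak* limits; only this easy inclusion of the commutation theorem is needed. -/
theorem inner_adjoint_of_mem_vonNeumannTensor {M₁ : VonNeumannAlgebra H₁}
    {M₂ : VonNeumannAlgebra H₂} {T : HilbertTensor H₁ H₂ →L[ℂ] HilbertTensor H₁ H₂}
    (hT : T ∈ vonNeumannTensor M₁ M₂) {a : H₁ →L[ℂ] H₁} (ha : a ∈ M₁.commutant)
    {b : H₂ →L[ℂ] H₂} (hb : b ∈ M₂.commutant) (x y : H₁) (z w : H₂) :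
    ⟪leftTensor H₂ (ContinuousLinearMap.adjoint a x) (ContinuousLinearMap.adjoint b z),
      T (leftTensor H₂ y w)⟫_ℂ =
    ⟪leftTensor H₂ x z, T (leftTensor H₂ (a y) (b w))⟫_ℂ := by
  refine inner_eq_of_mem_weakStarClosure ?_ hT
  rintro _ ⟨m, hm, n, hn, rfl⟩
  rw [VonNeumannAlgebra.mem_commutant_iff] at ha hb
  have h₁ : m (a y) = a (m y) := congr($(ha m hm) y)
  have h₂ : n (b w) = b (n w) := congr($(hb n hn) w)
  simp only [tensorOperator_leftTensor, inner_leftTensor, ContinuousLinearMap.adjoint_inner_left,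
    h₁, h₂]

theorem slice_adjoint {M₁ : VonNeumannAlgebra H₁} {M₂ : VonNeumannAlgebra H₂}
    {T : HilbertTensor H₁ H₂ →L[ℂ] HilbertTensor H₁ H₂} (hT : T ∈ vonNeumannTensor M₁ M₂)
    {a : H₁ →L[ℂ] H₁} (ha : a ∈ M₁.commutant) (x y : H₁) :
    slice (ContinuousLinearMap.adjoint a x) y T = slice x (a y) T := by
  ext w
  refine ext_inner_left ℂ fun z => ?_
  simpa [inner_slice, ← ContinuousLinearMap.star_eq_adjoint] using
    inner_adjoint_of_mem_vonNeumannTensor hT ha (one_mem M₂.commutant) x y z w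

theorem slice_mem {M₁ : VonNeumannAlgebra H₁} {M₂ : VonNeumannAlgebra H₂}
    {T : HilbertTensor H₁ H₂ →L[ℂ] HilbertTensor H₁ H₂} (hT : T ∈ vonNeumannTensor M₁ M₂)
    (x y : H₁) : slice x y T ∈ M₂ := by
  refine M₂.mem_of_commutes fun b hb z w => ?_
  simpa [inner_slice, ← ContinuousLinearMap.star_eq_adjoint] using
    inner_adjoint_of_mem_vonNeumannTensor hT (one_mem M₁.commutant) hb x y z w

theorem tensorOperator_mem_vonNeumannTensor {M₁ : VonNeumannAlgebra H₁}
    {M₂ : VonNeumannAlgebra H₂} {a : H₁ →L[ℂ] H₁} (ha : a ∈ M₁) {b : H₂ →L[ℂ] H₂} (hb : b ∈ M₂) :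
    tensorOperator a b ∈ vonNeumannTensor M₁ M₂ :=
  subset_closure (X := WeakBilin (operatorPairing (HilbertTensor H₁ H₂)))
    (Submodule.subset_span ⟨a, ha, b, hb, rfl⟩)

theorem slicedMap_apply_of_mem {M₁ : VonNeumannAlgebra H₁} {M₂ : VonNeumannAlgebra H₂}
    (hP : ∀ T ∈ vonNeumannTensor M₁ M₂, P T = T) (x y : H₁)
    {b : H₁ →L[ℂ] H₁} (hb : b ∈ M₁) {c : H₂ →L[ℂ] H₂} (hc : c ∈ M₂) :
    slicedMap hC x y b c = ⟪x, b y⟫_ℂ • c := by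
  ext w
  refine ext_inner_left ℂ fun z => ?_
  rw [slicedMap_apply, inner_slice, hP _ (tensorOperator_mem_vonNeumannTensor hb hc),
    tensorOperator_leftTensor, inner_leftTensor, smul_apply, inner_smul_right]

/-- The sesquilinear form `(x, y) ↦ τ (c ↦ (⟪x, · y⟫ ⊗ id) (P (b ⊗ c)))`. -/
def slicedForm (τ : StrongDual ℂ ((H₂ →L[ℂ] H₂) →L[ℂ] (H₂ →L[ℂ] H₂))) (b : H₁ →L[ℂ] H₁) :
    H₁ →L⋆[ℂ] H₁ →L[ℂ] ℂ :=
  LinearMap.mkContinuous₂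
    (LinearMap.mk₂'ₛₗ (starRingEnd ℂ) (RingHom.id ℂ) (fun x y => τ (slicedMap hC x y b))
      (by simp [slicedMap_add_left]) (by simp [slicedMap_smul_left])
      (by simp [slicedMap_add_middle]) (by simp [slicedMap_smul_middle]))
    (‖τ‖ * C * ‖b‖) fun x y => by
      refine (τ.le_of_opNorm_le_of_le le_rfl (norm_slicedMap_le hC x y b)).trans_eq ?_
      ring

/-! ### The induced projection onto `M₁`. -/

variable (τ : StrongDual ℂ ((H₂ →L[ℂ] H₂) →L[ℂ] (H₂ →L[ℂ] H₂)))

/-- The operator of the sesquilinear form `slicedForm hC τ b`. -/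
def slicedOperator (b : H₁ →L[ℂ] H₁) : H₁ →L[ℂ] H₁ :=
  ContinuousLinearMap.adjoint (InnerProductSpace.continuousLinearMapOfBilin (slicedForm hC τ b))

theorem inner_slicedOperator (b : H₁ →L[ℂ] H₁) (x y : H₁) :
    ⟪x, slicedOperator hC τ b y⟫_ℂ = τ (slicedMap hC x y b) := by
  rw [slicedOperator, ContinuousLinearMap.adjoint_inner_right,
    InnerProductSpace.continuousLinearMapOfBilin_apply]
  rfl

theorem norm_slicedOperator_le (b : H₁ →L[ℂ] H₁) :
    ‖slicedOperator hC τ b‖ ≤ ‖τ‖ * C * ‖b‖ := by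
  rw [slicedOperator, LinearIsometryEquiv.norm_map]
  refine ContinuousLinearMap.opNorm_le_bound _ (by positivity) fun x => ?_
  have h : ‖slicedForm hC τ b‖ ≤ ‖τ‖ * C * ‖b‖ :=
    LinearMap.mkContinuous₂_norm_le _ (by positivity) _
  calc ‖InnerProductSpace.continuousLinearMapOfBilin (slicedForm hC τ b) x‖
      = ‖slicedForm hC τ b x‖ :=
        (InnerProductSpace.toDual ℂ H₁).symm.norm_map (slicedForm hC τ b x)
    _ ≤ ‖τ‖ * C * ‖b‖ * ‖x‖ := (slicedForm hC τ b).le_of_opNorm_le h x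

/-- By `slice_adjoint`, the sliced maps for `(a* x, y)` and `(x, a y)` coincide when `a` is in the
commutant, before `τ` is applied; hence no weak* continuity of `τ` or `P` is required. -/
theorem slicedOperator_mem {M₁ : VonNeumannAlgebra H₁} {M₂ : VonNeumannAlgebra H₂}
    (hmem : ∀ T, P T ∈ vonNeumannTensor M₁ M₂) (b : H₁ →L[ℂ] H₁) : slicedOperator hC τ b ∈ M₁ :=
  M₁.mem_of_commutes fun a ha x y => by
    rw [inner_slicedOperator, inner_slicedOperator]
    congr 1
    ext c : 1
    exact slice_adjoint (hmem _) ha x y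

theorem projectionConstant_le_enorm_mul_enorm {M₁ : VonNeumannAlgebra H₁}
    {M₂ : VonNeumannAlgebra H₂} (hC : ∀ T, ‖P T‖ ≤ C * ‖T‖)
    (hmem : ∀ T, P T ∈ vonNeumannTensor M₁ M₂)
    (hP : ∀ T ∈ vonNeumannTensor M₁ M₂, P T = T)
    (hτ : ∀ (R : (H₂ →L[ℂ] H₂) →L[ℂ] (H₂ →L[ℂ] H₂)) (t : ℂ),
      (∀ c, R c ∈ M₂) → (∀ c ∈ M₂, R c = t • c) → τ R = t) :
    projectionConstant (Subalgebra.toSubmodule M₁.toSubalgebra) ≤ ‖τ‖ₑ * C := by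
  let P₁ : (H₁ →L[ℂ] H₁) →L[ℂ] (H₁ →L[ℂ] H₁) :=
    LinearMap.mkContinuous
      { toFun := slicedOperator hC τ
        map_add' := fun b b' => by
          ext y
          refine ext_inner_left ℂ fun x => ?_
          simp [inner_slicedOperator, inner_add_right, slicedMap_add_right]
        map_smul' := fun t b => by
          ext y
          refine ext_inner_left ℂ fun x => ?_
          simp [inner_slicedOperator, inner_smul_right, slicedMap_smul_right] }
      (‖τ‖ * C) (norm_slicedOperator_le hC τ)
  have hP₁ (b : H₁ →L[ℂ] H₁) (hb : b ∈ M₁) : P₁ b = b := by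
    ext y
    refine ext_inner_left ℂ fun x => (inner_slicedOperator hC τ b x y).trans ?_
    exact hτ _ _ (fun c => slice_mem (hmem _) x y)
      fun c hc => slicedMap_apply_of_mem hC hP x y hb hc
  have hnorm : ‖P₁‖ ≤ ‖τ‖ * C := LinearMap.mkContinuous_norm_le _ (by positivity) _
  refine (projectionConstant_le (P := P₁) (slicedOperator_mem hC τ hmem) hP₁).trans ?_
  rw [enorm_eq_nnnorm, enorm_eq_nnnorm]
  exact_mod_cast hnorm

end Tensor

end

theorem proposition2 {H₁ H₂ : Type*}
    [NormedAddCommGroup H₁] [InnerProductSpace ℂ H₁] [CompleteSpace H₁]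
    [NormedAddCommGroup H₂] [InnerProductSpace ℂ H₂] [CompleteSpace H₂]
    (M₁ : VonNeumannAlgebra H₁) (M₂ : VonNeumannAlgebra H₂) :
    projectionConstant (B := HilbertTensor H₁ H₂ →L[ℂ] HilbertTensor H₁ H₂)
        (vonNeumannTensor M₁ M₂) ≥
      projectionConstant (Subalgebra.toSubmodule M₁.toSubalgebra) *
        projectionConstant (Subalgebra.toSubmodule M₂.toSubalgebra) := by
  refine le_projectionConstant fun P C hC hmem hP => ?_
  rcases eq_or_ne (projectionConstant (Subalgebra.toSubmodule M₂.toSubalgebra)) 0 with h | h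
  · simp [h]
  obtain ⟨τ, hτ, hscalar⟩ := exists_scalar_functional h
  have hτ' : ‖τ‖ₑ ≤ (projectionConstant (Subalgebra.toSubmodule M₂.toSubalgebra))⁻¹ := by
    rw [← ofReal_norm]
    exact ENNReal.ofReal_le_of_le_toReal hτ
  rw [mul_comm]
  calc _ ≤ projectionConstant (Subalgebra.toSubmodule M₂.toSubalgebra) *
        ((projectionConstant (Subalgebra.toSubmodule M₂.toSubalgebra))⁻¹ * (C : ENNReal)) := by
        gcongr
        exact (projectionConstant_le_enorm_mul_enorm τ hC hmem hP hscalar).trans (by gcongr)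
    _ ≤ (C : ENNReal) := by
        rw [mul_comm _ (C : ENNReal), ← div_eq_mul_inv]
        -- Valid also when the constant of `M₂` is `∞`, where its inverse is `0`.
        exact ENNReal.mul_div_le
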